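/- Let $\mathcal B$ be the Bargmann space of entire functions $\varphi:\mathbb C\to\mathbb C$ with $\varphi(0)=0$ and $\int_{\mathbb C}e^{-|z|^2}|\varphi(z)|^2\,dx\,dy<\infty$, with inner product $\langle\varphi,\psi\rangle=\frac1\pi\int_{\mathbb C}e^{-|z|^2}\varphi(z)\overline{\psi(z)}\,dx\,dy$, and let $e_k(z)=z^k/\sqrt{k!}$, $k\ge1$. Let $G$ be the operator $G\varphi=A^{*3}A^3\varphi$, where $A=\frac{d}{dz}$ and $A^*$ is multiplication by $z$, that is $(G\varphi)(z)=z^3\varphi'''(z)$, with domain $\mathcal D(G)=\{\varphi\in\mathcal B: G\varphi\in\mathcal B\}$. For $\beta>0$ let $H_0^\beta\varphi=\sum_{k\ge1}k^\beta\langle\varphi,e_k\rangle e_k$, with domain $\mathcal D(H_0^\beta)=\{\varphi\in\mathcal B:\sum_{k\ge1}k^{2\beta}|\langle\varphi,e_k\rangle|^2<\infty\}$. Let $n\in\mathbb N$, let $a\ge 7/5$ be real, and put $p_{12}=p_{21}=\frac13$ and $p_{ij}=a^{-(i+j)}$ for all other pairs $i\ne j$ in $\{1,\dots,n\}$. Let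 $\lambda''\in\mathbb R\setminus\{0\}$. In the Hilbert space $\mathcal B^n$ (orthogonal sum of $n$ copies of $\mathcal B$) consider the unbounded operator matrix $$\mathcal M=\lambda''\,\mathrm{Diag}(G,\dots,G)+\big((1-\delta_{ij})\,p_{ij}\,H_0^{3p_{ij}}\big)_{1\le i,j\le n}$$ with its natural domain $\bigoplus_{j=1}^n\bigcap_{i=1}^n\mathcal D(\mathcal M_{ij})$, where $\mathcal M_{jj}=\lambda''G$ and $\mathcal M_{ij}=p_{ij}H_0^{3p_{ij}}$ for $i\neq j$. If $5/|\lambda''|<1$, then $\sigma(\mathcal M)\subset\mathbb R$, and $\mathcal B^n$ has an orthonormal basis consisting of eigenvectors of $\mathcal M$. -/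

import Mathlib

open MeasureTheory

noncomputable section

namespace Gribov

/-! ### The Bargmann space -/

/-- The weighted square-modulus `e^{-|z|²} |φ(z)|²`. -/
def weightedSq (φ : ℂ → ℂ) (z : ℂ) : ℝ := Real.exp (-‖z‖ ^ 2) * ‖φ z‖ ^ 2

/-- If `φ`, `ψ` are continuous and weighted square integrable, then so is the integrand of their
inner product. -/
theorem integrable_inner {φ ψ : ℂ → ℂ} (hφ : Continuous φ) (hψ : Continuous ψ)
    (iφ : Integrable (weightedSq φ)) (iψ : Integrable (weightedSq ψ)) :
    Integrable (fun z : ℂ =>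
      (Real.exp (-‖z‖ ^ 2) : ℂ) * ((starRingEnd ℂ) (φ z) * ψ z)) := by
  refine (iφ.add iψ).mono' (Continuous.aestronglyMeasurable ?_) (ae_of_all _ fun z => ?_)
  · have : Continuous fun z : ℂ => Real.exp (-‖z‖ ^ 2) := by fun_prop
    exact (Complex.continuous_ofReal.comp this).mul
      ((Complex.continuous_conj.comp hφ).mul hψ)
  · have h0 := Real.exp_pos (-‖z‖ ^ 2)
    simp only [weightedSq, Pi.add_apply, norm_mul, Complex.norm_real, Real.norm_eq_abs,
      abs_of_pos h0, RCLike.norm_conj]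
    rw [← mul_add]
    refine mul_le_mul_of_nonneg_left ?_ h0.le
    nlinarith [sq_nonneg (‖φ z‖ - ‖ψ z‖), sq_nonneg (‖φ z‖ + ‖ψ z‖)]

/-- The entire functions `φ` with `∫ e^{-|z|²} |φ(z)|² dx dy < ∞` and `φ(0) = 0`. -/
def bargmannSubmodule : Submodule ℂ (ℂ → ℂ) where
  carrier := {φ | Differentiable ℂ φ ∧ Integrable (weightedSq φ) ∧ φ 0 = 0}
  zero_mem' := ⟨differentiable_const 0, by
    have : weightedSq 0 = 0 := by funext z; simp [weightedSq]
    rw [this]; exact integrable_zero _ _ _, rfl⟩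
  add_mem' := by
    rintro φ ψ ⟨dφ, iφ, zφ⟩ ⟨dψ, iψ, zψ⟩
    refine ⟨dφ.add dψ, ?_, by simp [zφ, zψ]⟩
    refine ((iφ.const_mul 2).add (iψ.const_mul 2)).mono' (Continuous.aestronglyMeasurable ?_)
      (ae_of_all _ fun z => ?_)
    · have h := (dφ.add dψ).continuous
      unfold weightedSq
      fun_prop
    · have h0 := Real.exp_pos (-‖z‖ ^ 2)
      have h1 : ‖φ z + ψ z‖ ^ 2 ≤ 2 * ‖φ z‖ ^ 2 + 2 * ‖ψ z‖ ^ 2 := by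
        have := norm_add_le (φ z) (ψ z)
        nlinarith [norm_nonneg (φ z + ψ z), sq_nonneg (‖φ z‖ - ‖ψ z‖)]
      simp only [weightedSq, Pi.add_apply]
      rw [Real.norm_eq_abs, abs_of_nonneg (by positivity)]
      nlinarith [mul_le_mul_of_nonneg_left h1 h0.le]
  smul_mem' := by
    rintro c φ ⟨dφ, iφ, zφ⟩
    refine ⟨dφ.const_smul c, ?_, by simp [zφ]⟩
    have : weightedSq (c • φ) = fun z => ‖c‖ ^ 2 * weightedSq φ z := by
      funext z; simp [weightedSq]; ring
    rw [this]; exact iφ.const_mul _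

/-- The Bargmann space `𝓑`. -/
def Bargmann : Type := bargmannSubmodule

namespace Bargmann

instance : AddCommGroup Bargmann := inferInstanceAs (AddCommGroup bargmannSubmodule)

instance : Module ℂ Bargmann := inferInstanceAs (Module ℂ bargmannSubmodule)

instance : CoeFun Bargmann (fun _ => ℂ → ℂ) := ⟨fun φ => φ.1⟩

theorem ext {φ ψ : Bargmann} (h : ∀ z, φ z = ψ z) : φ = ψ := Subtype.ext (funext h)

theorem add_apply (φ ψ : Bargmann) (z : ℂ) : (φ + ψ) z = φ z + ψ z := rfl

theorem smul_apply (c : ℂ) (φ : Bargmann) (z : ℂ) : (c • φ) z = c * φ z := rfl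

theorem zero_apply (z : ℂ) : (0 : Bargmann) z = 0 := rfl

theorem differentiable (φ : Bargmann) : Differentiable ℂ φ := φ.2.1

theorem integrable (φ : Bargmann) : Integrable (weightedSq φ) := φ.2.2.1

/-- The inner product `(1/π) ∫ e^{-|z|²} conj(φ(z)) ψ(z) dx dy`. As everywhere in Mathlib it is
conjugate-linear in the first variable. -/
def innerProd (φ ψ : Bargmann) : ℂ :=
  (1 / Real.pi : ℂ) *
    ∫ z : ℂ, (Real.exp (-‖z‖ ^ 2) : ℂ) * ((starRingEnd ℂ) (φ z) * ψ z)

theorem innerProd_self (φ : Bargmann) :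
    innerProd φ φ = ((1 / Real.pi * ∫ z : ℂ, weightedSq φ z : ℝ) : ℂ) := by
  have : ∀ z : ℂ, (Real.exp (-‖z‖ ^ 2) : ℂ) * ((starRingEnd ℂ) (φ z) * φ z)
      = ((weightedSq φ z : ℝ) : ℂ) := by
    intro z
    rw [mul_comm ((starRingEnd ℂ) (φ z)), Complex.mul_conj, Complex.normSq_eq_norm_sq]
    simp [weightedSq]
  unfold innerProd
  simp only [this]
  rw [integral_complex_ofReal]
  push_cast
  rfl

/-- The inner product space structure of the Bargmann space. -/
@[reducible] def core : InnerProductSpace.Core ℂ Bargmann where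
  inner := innerProd
  conj_inner_symm φ ψ := by
    simp only [innerProd, map_mul, ← integral_conj, map_div₀, map_one, Complex.conj_ofReal,
      Complex.conj_conj]
    congr 2
    funext z
    ring
  re_inner_nonneg φ := by
    rw [innerProd_self]
    have h : 0 ≤ ∫ z : ℂ, weightedSq φ z :=
      integral_nonneg fun z => by unfold weightedSq; positivity
    simp only [RCLike.re_to_complex, Complex.ofReal_re]
    exact mul_nonneg (by positivity) h
  add_left φ ψ χ := by
    simp only [innerProd, ← mul_add]
    rw [← integral_add
      (integrable_inner φ.differentiable.continuous χ.differentiable.continuous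
        φ.integrable χ.integrable)
      (integrable_inner ψ.differentiable.continuous χ.differentiable.continuous
        ψ.integrable χ.integrable)]
    congr 2
    funext z
    rw [add_apply, map_add]
    ring
  smul_left φ ψ c := by
    simp only [innerProd]
    rw [mul_left_comm]
    congr 1
    rw [← integral_const_mul]
    congr 1
    funext z
    rw [smul_apply, map_mul]
    ring
  definite φ h := by
    rw [innerProd_self, Complex.ofReal_eq_zero] at h
    have h' : ∫ z : ℂ, weightedSq φ z = 0 := by
      rcases mul_eq_zero.1 h with h | h
      · exact absurd h (by positivity)
      · exact h
    rw [integral_eq_zero_iff_of_nonneg (fun z => by simp only [weightedSq, Pi.zero_apply]; positivity)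
      φ.integrable] at h'
    have hc : Continuous (weightedSq φ) := by
      have := φ.differentiable.continuous
      unfold weightedSq
      fun_prop
    have h2 := (Continuous.ae_eq_iff_eq volume hc continuous_zero).1 h'
    refine ext fun z => ?_
    have h3 := congrFun h2 z
    simpa [weightedSq, Real.exp_ne_zero, zero_apply] using h3

instance : NormedAddCommGroup Bargmann := core.toNormedAddCommGroup

instance : InnerProductSpace ℂ Bargmann := InnerProductSpace.ofCore core.toCore

/-- `z ^ k / √(k!)` belongs to the Bargmann space for `k ≥ 1`. -/
theorem monomial_mem (k : ℕ+) :
    (fun z : ℂ => z ^ (k : ℕ) / (Real.sqrt ((k : ℕ).factorial) : ℂ)) ∈ bargmannSubmodule := by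
  refine ⟨by fun_prop, ?_, by simp⟩
  have h1 : Integrable (fun z : ℂ => ‖z‖ ^ (2 * (k : ℕ) : ℝ) * Real.exp (-‖z‖ ^ (2 : ℝ))) := by
    refine not_imp_comm.1 integral_undef ?_
    rw [Complex.integral_rpow_mul_exp_neg_rpow one_le_two (by
      have : (0 : ℝ) ≤ (k : ℕ) := Nat.cast_nonneg _
      linarith)]
    have : 0 < Real.Gamma ((2 * (k : ℕ) + 2 : ℝ) / 2) := Real.Gamma_pos_of_pos (by positivity)
    have := Real.pi_pos
    positivity
  refine (h1.const_mul ((Real.sqrt ((k : ℕ).factorial) ^ 2)⁻¹)).congr (ae_of_all _ fun z => ?_)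
  have h2 : ‖z‖ ^ (2 * (k : ℕ) : ℝ) = ‖z‖ ^ (2 * (k : ℕ)) := by
    rw [← Real.rpow_natCast]; push_cast; rfl
  simp only [weightedSq, norm_div, norm_pow, Complex.norm_real, Real.norm_eq_abs,
    abs_of_nonneg (Real.sqrt_nonneg _), h2, Real.rpow_two]
  rw [pow_mul']
  ring

/-- The basis functions `e_k(z) = z ^ k / √(k!)`, `k ≥ 1`. -/
def e (k : ℕ+) : Bargmann := ⟨_, monomial_mem k⟩

end Bargmann

/-! ### The entries -/

/-- The differential expression `A*³ A³ φ = z³ φ'''`. -/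
def gribovExpr (φ : ℂ → ℂ) (z : ℂ) : ℂ := z ^ 3 * iteratedDeriv 3 φ z

theorem gribovExpr_add {φ ψ : ℂ → ℂ} (hφ : Differentiable ℂ φ) (hψ : Differentiable ℂ ψ) :
    gribovExpr (φ + ψ) = gribovExpr φ + gribovExpr ψ := by
  funext z
  simp only [gribovExpr, Pi.add_apply]
  rw [iteratedDeriv_add hφ.contDiff.contDiffAt hψ.contDiff.contDiffAt, mul_add]

theorem gribovExpr_smul (c : ℂ) {φ : ℂ → ℂ} (hφ : Differentiable ℂ φ) :
    gribovExpr (c • φ) = c • gribovExpr φ := by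
  funext z
  simp only [gribovExpr, Pi.smul_apply, smul_eq_mul]
  rw [iteratedDeriv_const_smul hφ.contDiff.contDiffAt c, smul_eq_mul]
  ring

/-- The operator `G φ = A*³ A³ φ` with domain `{φ ∈ 𝓑 | G φ ∈ 𝓑}`. -/
def G : Bargmann →ₗ.[ℂ] Bargmann where
  domain :=
    { carrier := {φ | gribovExpr φ ∈ bargmannSubmodule}
      zero_mem' := by
        have h := gribovExpr_smul 0 (differentiable_const (0 : ℂ))
        rw [zero_smul, zero_smul] at h
        change gribovExpr 0 ∈ bargmannSubmodule
        rw [h]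
        exact bargmannSubmodule.zero_mem
      add_mem' := fun {φ ψ} hφ hψ => by
        change gribovExpr (φ.1 + ψ.1) ∈ bargmannSubmodule
        rw [gribovExpr_add φ.differentiable ψ.differentiable]
        exact bargmannSubmodule.add_mem hφ hψ
      smul_mem' := fun c φ hφ => by
        change gribovExpr (c • φ.1) ∈ bargmannSubmodule
        rw [gribovExpr_smul c φ.differentiable]
        exact bargmannSubmodule.smul_mem c hφ }
  toFun :=
    { toFun := fun φ => ⟨gribovExpr φ.1, φ.2⟩
      map_add' := fun φ ψ =>
        Subtype.ext (gribovExpr_add φ.1.differentiable ψ.1.differentiable)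
      map_smul' := fun c φ => Subtype.ext (gribovExpr_smul c φ.1.differentiable) }

/-- The graph of `H₀^β`: the pairs `(φ, ψ)` with `∑ k^{2β} |⟨φ, e_k⟩|² < ∞` and
`ψ = ∑ k^β ⟨φ, e_k⟩ e_k` (convergence in the norm of `𝓑`; since `𝓑` is complete and the `e_k` are
orthonormal, the first condition makes the series converge). -/
def H0powGraph (β : ℝ) : Submodule ℂ (Bargmann × Bargmann) where
  carrier := {x |
    Summable (fun k : ℕ+ => ((k : ℕ) : ℝ) ^ (2 * β) * ‖inner ℂ (Bargmann.e k) x.1‖ ^ 2) ∧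
    HasSum (fun k : ℕ+ =>
      ((((k : ℕ) : ℝ) ^ β : ℝ) * inner ℂ (Bargmann.e k) x.1 : ℂ) • Bargmann.e k) x.2}
  zero_mem' := by
    constructor
    · simp
    · simp
  add_mem' := by
    rintro ⟨φ, ψ⟩ ⟨φ', ψ'⟩ ⟨hs, hψ⟩ ⟨hs', hψ'⟩
    dsimp only at hs hψ hs' hψ'
    constructor
    · refine Summable.of_nonneg_of_le (fun k => by positivity) (fun k => ?_)
        ((hs.mul_left 2).add (hs'.mul_left 2))
      have h0 : 0 ≤ ((k : ℕ) : ℝ) ^ (2 * β) := by positivity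
      have h1 : ‖inner ℂ (Bargmann.e k) (φ + φ')‖ ^ 2 ≤
          2 * ‖inner ℂ (Bargmann.e k) φ‖ ^ 2 + 2 * ‖inner ℂ (Bargmann.e k) φ'‖ ^ 2 := by
        rw [inner_add_right]
        have := norm_add_le (inner ℂ (Bargmann.e k) φ) (inner ℂ (Bargmann.e k) φ')
        nlinarith [norm_nonneg (inner ℂ (Bargmann.e k) φ + inner ℂ (Bargmann.e k) φ'),
          sq_nonneg (‖inner ℂ (Bargmann.e k) φ‖ - ‖inner ℂ (Bargmann.e k) φ'‖)]
      have h2 := mul_le_mul_of_nonneg_left h1 h0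
      simp only [Prod.mk_add_mk]
      linarith
    · simpa [inner_add_right, mul_add, add_smul] using hψ.add hψ'
  smul_mem' := by
    rintro c ⟨φ, ψ⟩ ⟨hs, hψ⟩
    dsimp only at hs hψ
    constructor
    · refine (hs.mul_left (‖c‖ ^ 2)).congr fun k => ?_
      simp only [Prod.smul_mk, inner_smul_right, norm_mul]
      ring
    · simpa [inner_smul_right, smul_smul, mul_left_comm] using hψ.const_smul c

/-- The operator `H₀^β φ = ∑_{k ≥ 1} k^β ⟨φ, e_k⟩ e_k`. -/
def H0pow (β : ℝ) : Bargmann →ₗ.[ℂ] Bargmann := (H0powGraph β).toLinearPMap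

theorem H0powGraph_functional (β : ℝ) :
    ∀ x ∈ H0powGraph β, x.1 = 0 → x.2 = 0 := by
  rintro ⟨φ, ψ⟩ ⟨_, h⟩ (rfl : φ = 0)
  refine h.unique ?_
  simp

theorem H0pow_graph (β : ℝ) : (H0pow β).graph = H0powGraph β :=
  Submodule.toLinearPMap_graph_eq _ (H0powGraph_functional β)

theorem mem_H0pow_domain_iff (β : ℝ) (φ : Bargmann) :
    φ ∈ (H0pow β).domain ↔ ∃ ψ, (φ, ψ) ∈ H0powGraph β := by
  rw [LinearPMap.mem_domain_iff, H0pow_graph]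

theorem H0pow_hasSum (β : ℝ) (φ : (H0pow β).domain) :
    HasSum (fun k : ℕ+ =>
      ((((k : ℕ) : ℝ) ^ β : ℝ) * inner ℂ (Bargmann.e k) (φ : Bargmann) : ℂ) • Bargmann.e k)
      (H0pow β φ) := by
  have h := (H0pow β).mem_graph φ
  rw [H0pow_graph] at h
  exact h.2

/-! ### Unbounded operator matrices, spectrum, bases of eigenvectors -/

section Abstract

variable {E : Type*} [NormedAddCommGroup E] [InnerProductSpace ℂ E]

/-- The operator matrix `(A i j)` acting in the Hilbert sum of `n` copies of `E`, with its natural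
domain `⨁_j ⋂_i D(A i j)`; the `i`-th component of the image of `U` is `∑_j A i j (U j)`. -/
def operatorMatrix {n : ℕ} (A : Fin n → Fin n → E →ₗ.[ℂ] E) :
    PiLp 2 (fun _ : Fin n => E) →ₗ.[ℂ] PiLp 2 (fun _ : Fin n => E) where
  domain :=
    { carrier := {U | ∀ j i, U j ∈ (A i j).domain}
      zero_mem' := fun j i => (A i j).domain.zero_mem
      add_mem' := fun hU hV j i => (A i j).domain.add_mem (hU j i) (hV j i)
      smul_mem' := fun c _ hU j i => (A i j).domain.smul_mem c (hU j i) }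
  toFun :=
    { toFun := fun U => WithLp.toLp 2 fun i => ∑ j, A i j ⟨U.1 j, U.2 j i⟩
      map_add' := fun U V => by
        ext i
        simp only [PiLp.add_apply, ← Finset.sum_add_distrib, ← LinearPMap.map_add]
        rfl
      map_smul' := fun c U => by
        ext i
        simp only [PiLp.smul_apply, RingHom.id_apply, Finset.smul_sum, ← LinearPMap.map_smul]
        rfl }

/-- `z` is in the resolvent set of `T` when `T - z : D(T) → E` is bijective with a bounded
inverse `R : E → D(T)`. -/
def IsRegularPoint (T : E →ₗ.[ℂ] E) (z : ℂ) : Prop :=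
  ∃ R : E →L[ℂ] E,
    (∀ y : E, ∃ h : R y ∈ T.domain, T ⟨R y, h⟩ - z • R y = y) ∧
    ∀ x : T.domain, R (T x - z • (x : E)) = x

/-- The spectrum of an unbounded operator. -/
def spectrum (T : E →ₗ.[ℂ] E) : Set ℂ := {z | ¬ IsRegularPoint T z}

/-- `T` admits an orthonormal (Hilbert) basis consisting of eigenvectors. -/
def HasOrthonormalEigenbasis (T : E →ₗ.[ℂ] E) : Prop :=
  ∃ (ι : Type) (b : HilbertBasis ι ℂ E), ∀ i : ι,
    ∃ (h : b i ∈ T.domain) (μ : ℂ), T ⟨b i, h⟩ = μ • b i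

end Abstract

/-! ### The example -/

/-- The double sequence `p_{ij}`, with indices counted from `1`. -/
def p (a : ℝ) (i j : ℕ) : ℝ :=
  if (i = 1 ∧ j = 2) ∨ (i = 2 ∧ j = 1) then 1 / 3 else 1 / a ^ (i + j)

/-- The `n × n` Gribov operator matrix with diagonal entries `λ'' G` and off-diagonal entries
`p_{ij} H₀^{3 p_{ij}}`. An element `i : Fin n` stands for the index `i + 1 ∈ {1, …, n}`. -/
def gribovMatrix (n : ℕ) (a lam : ℝ) :
    PiLp 2 (fun _ : Fin n => Bargmann) →ₗ.[ℂ] PiLp 2 (fun _ : Fin n => Bargmann) :=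
  operatorMatrix fun i j =>
    if i = j then (lam : ℂ) • G
    else (p a (i + 1) (j + 1) : ℂ) • H0pow (3 * p a (i + 1) (j + 1))

end Gribov

end

/-! All entries are diagonal in the orthonormal basis `e k`: there $G$ multiplies the $k$-th
coefficient by $k(k-1)(k-2)$ and $H_0^\beta$ by $k^\beta$. Collecting the $k$-th coefficients of the
$n$ components into a vector of $\mathbb C^n$, the operator matrix acts on it by a real symmetric
matrix $M_k$ (`blockMatrix`). Diagonalizing every $M_k$ gives an orthonormal eigenbasis of $\mathcal
B^n$ with real eigenvalues, provided these vectors lie in the domain.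

The spectrum is real once the domain is maximal: if the vectors $M_ku_k$ are the coefficients of
some $V\in\mathcal B^n$, then $U$ must lie in the natural domain. For nonreal $z$ the resolvent is
then the multiplier $(\mu-z)^{-1}$, bounded by $1/|\mathrm{Im}\,z|$. Maximality holds because
$3p_{ij}\le 2$: off-diagonal entries of $M_k$ are at most $k^2$, while the diagonal grows like
$|\lambda''|k^3$, so for large $k$ the size of $k^3u_k$ is controlled by $M_ku_k$
(`cube_mul_norm_le`).

The analytic input is that $\varphi\mapsto(\sqrt{k!}\,\hat\varphi(k))_k$, with $\hat\varphi(k)$ the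
Taylor coefficients, is an isometry onto $\ell^2$. It follows from Parseval on circles, integrated
in polar coordinates (`lintegral_weightedSq`), and from the construction of entire functions with
prescribed coefficients (`exists_hasSum`). -/

namespace Gribov

/-! ### Power series of entire functions -/

/-- The coefficient of `z ^ n` in the Taylor expansion of `φ` at the origin. -/
noncomputable def taylorCoeff (φ : ℂ → ℂ) (n : ℕ) : ℂ := iteratedDeriv n φ 0 / n.factorial

theorem hasSum_taylorCoeff {φ : ℂ → ℂ} (hφ : Differentiable ℂ φ) (z : ℂ) :
    HasSum (fun n => taylorCoeff φ n * z ^ n) (φ z) := by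
  refine (Complex.hasSum_taylorSeries_of_entire hφ 0 z).congr_fun ?_
  intro n
  simp only [taylorCoeff, smul_eq_mul, sub_zero]
  ring

theorem hasFPowerSeriesOnBall_of_hasSum {φ : ℂ → ℂ} {a : ℕ → ℂ}
    (h : ∀ z, HasSum (fun n => a n * z ^ n) (φ z)) :
    HasFPowerSeriesOnBall φ (FormalMultilinearSeries.ofScalars ℂ a) 0 ⊤ where
  r_le := by
    rw [FormalMultilinearSeries.radius_eq_top_of_summable_norm]
    intro r
    -- In $\mathbb C$ summability implies absolute summability, so convergence at every positive
    -- real point already forces an infinite radius.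
    refine (h (r : ℂ)).summable.norm.congr fun n => ?_
    rw [FormalMultilinearSeries.ofScalars_norm]
    simp
  r_pos := by simp
  hasSum := by
    intro y _
    rw [zero_add]
    refine (h y).congr_fun fun n => ?_
    simp [mul_comm]

theorem differentiable_of_hasSum {φ : ℂ → ℂ} {a : ℕ → ℂ}
    (h : ∀ z, HasSum (fun n => a n * z ^ n) (φ z)) : Differentiable ℂ φ := by
  have := (hasFPowerSeriesOnBall_of_hasSum h).differentiableOn
  rwa [Metric.eball_top, differentiableOn_univ] at this

theorem taylorCoeff_of_hasSum {φ : ℂ → ℂ} {a : ℕ → ℂ}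
    (h : ∀ z, HasSum (fun n => a n * z ^ n) (φ z)) (n : ℕ) : taylorCoeff φ n = a n := by
  have h1 := (hasFPowerSeriesOnBall_of_hasSum h).hasFPowerSeriesAt
  have h2 := h1.analyticAt.hasFPowerSeriesAt
  have h3 := congrArg (fun q => FormalMultilinearSeries.coeff q n)
    (h2.eq_formalMultilinearSeries h1)
  rw [taylorCoeff]
  simpa only [FormalMultilinearSeries.coeff_ofScalars] using h3

theorem eq_of_taylorCoeff_eq {φ ψ : ℂ → ℂ} (hφ : Differentiable ℂ φ) (hψ : Differentiable ℂ ψ)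
    (h : ∀ n, taylorCoeff φ n = taylorCoeff ψ n) : φ = ψ := by
  funext z
  refine (hasSum_taylorCoeff hφ z).unique ?_
  simpa only [h] using hasSum_taylorCoeff hψ z

theorem taylorCoeff_zero (φ : ℂ → ℂ) : taylorCoeff φ 0 = φ 0 := by
  simp [taylorCoeff]

theorem differentiable_iteratedDeriv {φ : ℂ → ℂ} (hφ : Differentiable ℂ φ) (k : ℕ) :
    Differentiable ℂ (iteratedDeriv k φ) :=
  (hφ.contDiff (n := k + 1)).differentiable_iteratedDeriv k (by exact_mod_cast k.lt_succ_self)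

/-- The Taylor series of `z ^ 3 * φ'''`. -/
theorem hasSum_gribovExpr {φ : ℂ → ℂ} (hφ : Differentiable ℂ φ) (z : ℂ) :
    HasSum (fun n : ℕ => ((n : ℂ) * (n - 1) * (n - 2) * taylorCoeff φ n) * z ^ n)
      (gribovExpr φ z) := by
  have h := (hasSum_taylorCoeff (differentiable_iteratedDeriv hφ 3) z).mul_left (z ^ 3)
  -- The factor $n(n-1)(n-2)$ vanishes for $n=0,1,2$, so the series may start at $n=3$, where it
  -- matches $z^3$ times the series of $\varphi'''$.
  refine (hasSum_nat_add_iff' 3).1 ?_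
  simp only [Finset.sum_range_succ, Finset.sum_range_zero]
  norm_num
  refine h.congr_fun fun n => ?_
  have h1 : iteratedDeriv n (iteratedDeriv 3 φ) 0 = iteratedDeriv (n + 3) φ 0 := by
    simp only [iteratedDeriv_eq_iterate, Function.iterate_add_apply]
  have h2 : ((n.factorial : ℕ) : ℂ) ≠ 0 := by exact_mod_cast n.factorial_ne_zero
  have h3 : (n : ℂ) + 1 ≠ 0 := by exact_mod_cast n.succ_ne_zero
  have h4 : (n : ℂ) + 1 + 1 ≠ 0 := by exact_mod_cast (n + 1).succ_ne_zero
  have h7 : (n : ℂ) + 2 + 1 ≠ 0 := by exact_mod_cast (n + 2).succ_ne_zero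
  simp only [taylorCoeff, h1, Nat.factorial_succ]
  push_cast
  field_simp
  ring

theorem taylorCoeff_gribovExpr {φ : ℂ → ℂ} (hφ : Differentiable ℂ φ) (n : ℕ) :
    taylorCoeff (gribovExpr φ) n = (n : ℂ) * (n - 1) * (n - 2) * taylorCoeff φ n :=
  taylorCoeff_of_hasSum (hasSum_gribovExpr hφ) n

/-! ### The norm of an entire function in terms of its Taylor coefficients -/

/-- Termwise integration, dominated by the absolutely convergent Taylor series on the circle. The
weight `w` is an exponential for Cauchy's coefficient formula and $\overline\varphi$ for Parseval's
identity. -/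
theorem hasSum_integral_circle {φ : ℂ → ℂ} (hφ : Differentiable ℂ φ) {w : ℝ → ℂ}
    (hw : Continuous w) (r : ℝ) :
    HasSum (fun n : ℕ => taylorCoeff φ n * r ^ n *
        ∫ t in (-Real.pi)..Real.pi, Complex.exp (n * Complex.I * t) * w t)
      (∫ t in (-Real.pi)..Real.pi, φ (r * Complex.exp (Complex.I * t)) * w t) := by
  have hn : ∀ t : ℝ, ‖Complex.exp (Complex.I * t)‖ = 1 := fun t => by
    rw [mul_comm]; exact Complex.norm_exp_ofReal_mul_I t
  have hs : Summable fun n => ‖taylorCoeff φ n * (r : ℂ) ^ n‖ :=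
    (hasSum_taylorCoeff hφ r).summable.norm
  have h := intervalIntegral.hasSum_integral_of_dominated_convergence
    (a := -Real.pi) (b := Real.pi) (μ := volume)
    (F := fun n t => taylorCoeff φ n * (r * Complex.exp (Complex.I * t)) ^ n * w t)
    (f := fun t => φ (r * Complex.exp (Complex.I * t)) * w t)
    (fun n t => ‖taylorCoeff φ n * (r : ℂ) ^ n‖ * ‖w t‖)
    (fun n => by
      refine Continuous.aestronglyMeasurable ?_
      fun_prop)
    (fun n => ae_of_all _ fun t _ => by
      simp [hn])
    (ae_of_all _ fun t _ => hs.mul_right _)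
    (by
      simp only [tsum_mul_right]
      exact (continuous_const.mul hw.norm).intervalIntegrable _ _)
    (ae_of_all _ fun t _ => (hasSum_taylorCoeff hφ _).mul_right _)
  refine h.congr_fun fun n => ?_
  rw [← intervalIntegral.integral_const_mul]
  congr 1
  funext t
  rw [mul_pow, ← Complex.exp_nat_mul]
  ring_nf

theorem integral_exp_int_mul (m : ℤ) :
    ∫ t in (-Real.pi)..Real.pi, Complex.exp (m * Complex.I * t)
      = if m = 0 then (2 * Real.pi : ℂ) else 0 := by
  split_ifs with h
  · subst h
    simp
    ring
  · rw [integral_exp_mul_complex (by simp [h])]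
    have : Complex.exp (m * Complex.I * (Real.pi : ℝ))
        = Complex.exp (m * Complex.I * ((-Real.pi : ℝ) : ℂ)) := by
      rw [Complex.exp_eq_exp_iff_exists_int]
      exact ⟨m, by push_cast; ring⟩
    rw [this]
    simp

theorem integral_circle_mul_exp_neg {φ : ℂ → ℂ} (hφ : Differentiable ℂ φ) (r : ℝ) (k : ℕ) :
    ∫ t in (-Real.pi)..Real.pi, φ (r * Complex.exp (Complex.I * t)) *
      Complex.exp (-(k * Complex.I * t)) = 2 * Real.pi * (taylorCoeff φ k * r ^ k) := by
  have h := hasSum_integral_circle hφ (w := fun t => Complex.exp (-(k * Complex.I * t)))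
    (by fun_prop) r
  refine h.unique ?_
  have h1 : ∀ n : ℕ, ∫ t in (-Real.pi)..Real.pi,
      Complex.exp (n * Complex.I * t) * Complex.exp (-(k * Complex.I * t))
      = if n = k then (2 * Real.pi : ℂ) else 0 := by
    intro n
    have := integral_exp_int_mul ((n : ℤ) - k)
    simp only [sub_eq_zero, Nat.cast_inj] at this
    rw [← this]
    congr 1
    funext t
    rw [← Complex.exp_add]
    push_cast
    ring_nf
  simp only [h1]
  convert hasSum_single k ?_ using 1
  · simp; ring
  · intro n hn
    simp [hn]

/-- Parseval's identity on a circle. -/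
theorem hasSum_sq_circle {φ : ℂ → ℂ} (hφ : Differentiable ℂ φ) (r : ℝ) :
    HasSum (fun n : ℕ => 2 * Real.pi * (‖taylorCoeff φ n‖ ^ 2 * r ^ (2 * n)))
      (∫ t in (-Real.pi)..Real.pi, ‖φ (r * Complex.exp (Complex.I * t))‖ ^ 2) := by
  have hc := hφ.continuous
  -- With weight $\overline\varphi$, the $n$-th integral is the conjugate of Cauchy's formula for
  -- the $n$-th coefficient.
  have h := hasSum_integral_circle hφ
    (w := fun t => (starRingEnd ℂ) (φ (r * Complex.exp (Complex.I * t))))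
    (Complex.continuous_conj.comp (by fun_prop)) r
  have h1 : ∀ n : ℕ, ∫ t in (-Real.pi)..Real.pi, Complex.exp (n * Complex.I * t) *
      (starRingEnd ℂ) (φ (r * Complex.exp (Complex.I * t)))
      = (starRingEnd ℂ) (2 * Real.pi * (taylorCoeff φ n * r ^ n)) := by
    intro n
    rw [← integral_circle_mul_exp_neg hφ, ← intervalIntegral.intervalIntegral_conj]
    congr 1
    funext t
    rw [map_mul, ← Complex.exp_conj]
    simp
    ring
  rw [← Complex.hasSum_ofReal, ← intervalIntegral.integral_ofReal]
  convert h using 1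
  · funext n
    rw [h1]
    have := Complex.mul_conj' (taylorCoeff φ n)
    simp only [map_mul, map_pow, Complex.conj_ofReal, map_ofNat]
    push_cast
    rw [← this]
    ring
  · congr 1
    funext t
    rw [Complex.mul_conj']
    push_cast
    rfl

/-- The radial moment $\int_0^\infty r^{2n+1}e^{-r^2}dr=\Gamma(n+1)/2=n!/2$, the source of the
weights $n!$ in the norm. -/
theorem lintegral_pow_mul_exp (n : ℕ) :
    ∫⁻ r in Set.Ioi (0 : ℝ), ENNReal.ofReal (2 * Real.pi * (r * (Real.exp (-r ^ 2) * r ^ (2 * n))))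
      = ENNReal.ofReal (Real.pi * n.factorial) := by
  have h := integral_rpow_mul_exp_neg_rpow (p := 2) (q := 2 * n + 1) two_pos
    (by have : (0 : ℝ) ≤ n := n.cast_nonneg
        linarith)
  have e1 : ((2 * n + 1 + 1 : ℝ)) / 2 = n + 1 := by ring
  rw [e1, Real.Gamma_nat_eq_factorial] at h
  have h2 : ∫ r in Set.Ioi (0 : ℝ), r * (Real.exp (-r ^ 2) * r ^ (2 * n))
      = 1 / 2 * n.factorial := by
    rw [← h]
    refine setIntegral_congr_fun measurableSet_Ioi fun r _ => ?_
    have e2 : (2 * n + 1 : ℝ) = ((2 * n + 1 : ℕ) : ℝ) := by push_cast; ring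
    simp only [e2, Real.rpow_natCast, Real.rpow_two]
    ring
  have h3 : ∫ r in Set.Ioi (0 : ℝ), 2 * Real.pi * (r * (Real.exp (-r ^ 2) * r ^ (2 * n)))
      = Real.pi * n.factorial := by
    rw [integral_const_mul, h2]; ring
  rw [← h3, ofReal_integral_eq_lintegral_ofReal]
  -- The integral of a non-integrable function is $0$ by convention, so the nonzero value found
  -- above proves integrability.
  · refine not_imp_comm.1 integral_undef ?_
    rw [h3]
    have := Real.pi_pos
    positivity
  · refine (ae_restrict_iff' measurableSet_Ioi).2 (ae_of_all _ fun r hr => ?_)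
    have := Real.pi_pos
    have hr' : 0 < r := hr
    simp only [Pi.zero_apply]
    positivity

/-- The weighted square norm of an entire function in terms of its Taylor coefficients. -/
theorem lintegral_weightedSq {φ : ℂ → ℂ} (hφ : Differentiable ℂ φ) :
    ∫⁻ z : ℂ, ENNReal.ofReal (weightedSq φ z)
      = ENNReal.ofReal Real.pi *
        ∑' n : ℕ, ENNReal.ofReal (n.factorial * ‖taylorCoeff φ n‖ ^ 2) := by
  have hc := hφ.continuous
  have hpi := Real.pi_pos
  -- Polar coordinates, Parseval on each circle, then Tonelli. Values in $[0,\infty]$ avoid any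
  -- integrability assumption, so the formula can also be used to prove integrability.
  rw [← Complex.lintegral_comp_polarCoord_symm, polarCoord_target, Measure.volume_eq_prod,
    setLIntegral_prod]
  swap
  · refine Measurable.aemeasurable ?_
    have : Measurable fun q : ℝ × ℝ => (Complex.polarCoord.symm q : ℂ) := by
      simp only [Complex.polarCoord_symm_apply]
      fun_prop
    have h2 : Measurable (weightedSq φ) := by
      unfold weightedSq
      fun_prop
    simp only [smul_eq_mul]
    fun_prop
  have h1 : ∀ r ∈ Set.Ioi (0 : ℝ), ∫⁻ t in Set.Ioo (-Real.pi) Real.pi,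
      ENNReal.ofReal (r, t).1 • ENNReal.ofReal (weightedSq φ (Complex.polarCoord.symm (r, t)))
      = ∑' n : ℕ, ENNReal.ofReal (‖taylorCoeff φ n‖ ^ 2) *
        ENNReal.ofReal (2 * Real.pi * (r * (Real.exp (-r ^ 2) * r ^ (2 * n)))) := by
    intro r hr
    have hr' : 0 < r := hr
    have h2 : ∀ t : ℝ, ENNReal.ofReal (r, t).1 •
        ENNReal.ofReal (weightedSq φ (Complex.polarCoord.symm (r, t)))
        = ENNReal.ofReal (r * Real.exp (-r ^ 2) *
            ‖φ (r * Complex.exp (Complex.I * t))‖ ^ 2) := by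
      intro t
      rw [smul_eq_mul, ← ENNReal.ofReal_mul hr'.le, Complex.polarCoord_symm_apply]
      have e1 : ((Real.cos t : ℂ) + Real.sin t * Complex.I) = Complex.exp (Complex.I * t) := by
        rw [mul_comm Complex.I, Complex.exp_mul_I]; simp
      have e2 : ‖(r : ℂ) * Complex.exp (Complex.I * t)‖ = r := by
        rw [norm_mul, mul_comm Complex.I, Complex.norm_exp_ofReal_mul_I, mul_one,
          Complex.norm_real, Real.norm_eq_abs, abs_of_pos hr']
      simp only [weightedSq, e1, e2]
      rw [mul_assoc]
    simp only [h2]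
    have hs := (hasSum_sq_circle hφ r).mul_left (r * Real.exp (-r ^ 2))
    have hcont : Continuous fun t : ℝ => r * Real.exp (-r ^ 2) *
        ‖φ (r * Complex.exp (Complex.I * t))‖ ^ 2 := by fun_prop
    rw [Measure.restrict_congr_set Ioo_ae_eq_Ioc, ← ofReal_integral_eq_lintegral_ofReal,
      ← intervalIntegral.integral_of_le (by linarith), intervalIntegral.integral_const_mul,
      ← hs.tsum_eq, ENNReal.ofReal_tsum_of_nonneg _ hs.summable]
    · refine tsum_congr fun n => ?_
      rw [← ENNReal.ofReal_mul (by positivity)]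
      congr 1
      ring
    · intro n; positivity
    · exact (hcont.integrableOn_Icc).mono_set Set.Ioc_subset_Icc_self
    · exact ae_of_all _ fun t => by simp only [Pi.zero_apply]; positivity
  rw [setLIntegral_congr_fun measurableSet_Ioi h1, lintegral_tsum, ← ENNReal.tsum_mul_left]
  · refine tsum_congr fun n => ?_
    rw [lintegral_const_mul _ (by fun_prop), lintegral_pow_mul_exp,
      ← ENNReal.ofReal_mul (by positivity), ← ENNReal.ofReal_mul (by positivity)]
    congr 1
    ring
  · intro n
    fun_prop


open scoped lp

/-! ### The isometry between the Bargmann space and `ℓ²` -/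

theorem taylorCoeff_add {φ ψ : ℂ → ℂ} (hφ : Differentiable ℂ φ) (hψ : Differentiable ℂ ψ) (n : ℕ) :
    taylorCoeff (φ + ψ) n = taylorCoeff φ n + taylorCoeff ψ n := by
  rw [taylorCoeff, iteratedDeriv_add hφ.contDiff.contDiffAt hψ.contDiff.contDiffAt, add_div]
  rfl

theorem taylorCoeff_smul (c : ℂ) {φ : ℂ → ℂ} (hφ : Differentiable ℂ φ) (n : ℕ) :
    taylorCoeff (c • φ) n = c * taylorCoeff φ n := by
  rw [taylorCoeff, iteratedDeriv_const_smul hφ.contDiff.contDiffAt c, smul_eq_mul, mul_div_assoc]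
  rfl

namespace Bargmann

theorem apply_zero (φ : Bargmann) : φ 0 = 0 := φ.2.2.2

/-- The coefficients of an element of the Bargmann space in the basis `e`. -/
noncomputable def coeff (φ : Bargmann) (k : ℕ+) : ℂ :=
  (Real.sqrt (k : ℕ).factorial : ℂ) * taylorCoeff φ k

theorem sqrt_factorial_ne_zero (n : ℕ) : (Real.sqrt n.factorial : ℂ) ≠ 0 := by
  rw [Complex.ofReal_ne_zero]
  have : (0 : ℝ) < n.factorial := by exact_mod_cast n.factorial_pos
  positivity

theorem coeff_add (φ ψ : Bargmann) (k : ℕ+) : coeff (φ + ψ) k = coeff φ k + coeff ψ k := by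
  have := taylorCoeff_add φ.differentiable ψ.differentiable k
  rw [coeff, coeff, coeff, ← mul_add, ← this]
  rfl

theorem coeff_smul (c : ℂ) (φ : Bargmann) (k : ℕ+) : coeff (c • φ) k = c * coeff φ k := by
  have := taylorCoeff_smul c φ.differentiable k
  rw [coeff, coeff, mul_left_comm, ← this]
  rfl

theorem norm_sq_coeff (φ : Bargmann) (k : ℕ+) :
    ‖coeff φ k‖ ^ 2 = (k : ℕ).factorial * ‖taylorCoeff φ k‖ ^ 2 := by
  rw [coeff, norm_mul, mul_pow, Complex.norm_real, Real.norm_eq_abs, sq_abs,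
    Real.sq_sqrt (Nat.cast_nonneg _)]

/-- The condition $\varphi(0)=0$ removes the term $n=0$, leaving exactly the indices of the basis.
-/
theorem tsum_factorial_mul_eq {φ : ℂ → ℂ} (h0 : φ 0 = 0) :
    ∑' n : ℕ, ENNReal.ofReal (n.factorial * ‖taylorCoeff φ n‖ ^ 2)
      = ∑' k : ℕ+, ENNReal.ofReal ((k : ℕ).factorial * ‖taylorCoeff φ k‖ ^ 2) := by
  symm
  refine PNat.coe_injective.tsum_eq
    (f := fun n : ℕ => ENNReal.ofReal (n.factorial * ‖taylorCoeff φ n‖ ^ 2)) ?_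
  intro n hn
  rcases Nat.eq_zero_or_pos n with rfl | h
  · simp [taylorCoeff_zero, h0] at hn
  · exact ⟨⟨n, h⟩, rfl⟩

theorem weightedSq_nonneg (φ : ℂ → ℂ) (z : ℂ) : 0 ≤ weightedSq φ z := by
  unfold weightedSq; positivity

theorem norm_sq_eq (φ : Bargmann) : ‖φ‖ ^ 2 = 1 / Real.pi * ∫ z : ℂ, weightedSq φ z := by
  have h : inner ℂ φ φ = ((1 / Real.pi * ∫ z : ℂ, weightedSq φ z : ℝ) : ℂ) := innerProd_self φ
  rw [← inner_self_eq_norm_sq (𝕜 := ℂ), h]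
  simp

theorem ofReal_norm_sq (φ : Bargmann) :
    ENNReal.ofReal (‖φ‖ ^ 2) = ∑' k : ℕ+, ENNReal.ofReal (‖coeff φ k‖ ^ 2) := by
  have hpi := Real.pi_pos
  rw [norm_sq_eq, ENNReal.ofReal_mul (by positivity),
    ofReal_integral_eq_lintegral_ofReal φ.integrable (ae_of_all _ (weightedSq_nonneg φ)),
    lintegral_weightedSq φ.differentiable, ← mul_assoc, ← ENNReal.ofReal_mul (by positivity),
    one_div, inv_mul_cancel₀ hpi.ne', ENNReal.ofReal_one, one_mul,
    tsum_factorial_mul_eq φ.apply_zero]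
  simp only [norm_sq_coeff]

theorem hasSum_norm_sq_coeff (φ : Bargmann) : HasSum (fun k => ‖coeff φ k‖ ^ 2) (‖φ‖ ^ 2) := by
  have h := ofReal_norm_sq φ
  have hs : Summable (fun k => ‖coeff φ k‖ ^ 2) := by
    have h1 : ∑' k : ℕ+, ENNReal.ofReal (‖coeff φ k‖ ^ 2) ≠ ⊤ := by
      rw [← h]; exact ENNReal.ofReal_ne_top
    refine (ENNReal.summable_toReal h1).congr fun k => ?_
    rw [ENNReal.toReal_ofReal (by positivity)]
  rw [← ENNReal.ofReal_tsum_of_nonneg (fun k => by positivity) hs,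
    ENNReal.ofReal_eq_ofReal_iff (by positivity) (tsum_nonneg fun k => by positivity)] at h
  rw [h]
  exact hs.hasSum

theorem memlp_iff {c : ℕ+ → ℂ} : Memℓp c 2 ↔ Summable fun k => ‖c k‖ ^ 2 := by
  rw [memℓp_gen_iff (by norm_num)]
  norm_num

/-- Surjectivity of the coefficient map onto $\ell^2$, and hence the completeness of $\mathcal B$:
the function is the sum of $c_kz^k/\sqrt{k!}$. -/
theorem exists_hasSum {c : ℕ+ → ℂ} (hc : Summable fun k => ‖c k‖ ^ 2) :
    ∃ φ : Bargmann, ∀ k, coeff φ k = c k := by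
  classical
  set c' : ℕ → ℂ := Function.extend PNat.val c 0 with hc'
  have hck : ∀ k : ℕ+, c' k = c k := fun k => PNat.coe_injective.extend_apply c 0 k
  have hc0 : c' 0 = 0 := by
    rw [hc', Function.extend_apply']
    · rfl
    · rintro ⟨k, hk⟩
      exact k.ne_zero hk
  have hs : Summable fun n => ‖c' n‖ ^ 2 := by
    refine (PNat.coe_injective.summable_iff ?_).1 (hc.congr fun k => ?_)
    · intro n hn
      rcases Nat.eq_zero_or_pos n with rfl | h
      · simp [hc0]
      · exact absurd ⟨⟨n, h⟩, rfl⟩ hn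
    · simp [hck]
  set a : ℕ → ℂ := fun n => c' n / (Real.sqrt n.factorial : ℂ) with ha
  have hsum : ∀ z : ℂ, Summable fun n => a n * z ^ n := by
    intro z
    -- From $xy\le x^2+y^2$: $|c_n||z|^n/\sqrt{n!}\le|c_n|^2+|z|^{2n}/n!$, and the second series is
    -- that of $e^{|z|^2}$.
    refine Summable.of_norm_bounded (hs.add (Real.summable_pow_div_factorial (‖z‖ ^ 2))) fun n => ?_
    have h1 : (0 : ℝ) < n.factorial := by exact_mod_cast n.factorial_pos
    have h2 : ‖a n * z ^ n‖ = ‖c' n‖ * (‖z‖ ^ n / Real.sqrt n.factorial) := by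
      simp only [ha, norm_mul, norm_div, norm_pow, Complex.norm_real, Real.norm_eq_abs,
        abs_of_nonneg (Real.sqrt_nonneg _)]
      ring
    have h3 : (‖z‖ ^ 2) ^ n / n.factorial = (‖z‖ ^ n / Real.sqrt n.factorial) ^ 2 := by
      rw [div_pow, Real.sq_sqrt h1.le]
      ring
    rw [h2, h3]
    nlinarith [sq_nonneg (‖c' n‖ - ‖z‖ ^ n / Real.sqrt n.factorial), sq_nonneg ‖c' n‖,
      sq_nonneg (‖z‖ ^ n / Real.sqrt n.factorial)]
  set φ : ℂ → ℂ := fun z => ∑' n, a n * z ^ n with hφ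
  have hφs : ∀ z, HasSum (fun n => a n * z ^ n) (φ z) := fun z => (hsum z).hasSum
  have hd : Differentiable ℂ φ := differentiable_of_hasSum hφs
  have ht : ∀ n, taylorCoeff φ n = a n := taylorCoeff_of_hasSum hφs
  have h0 : φ 0 = 0 := by
    rw [← taylorCoeff_zero φ, ht]
    simp [ha, hc0]
  have hcoeff : ∀ k : ℕ+, (Real.sqrt (k : ℕ).factorial : ℂ) * taylorCoeff φ k = c k := by
    intro k
    rw [ht, ha, ← hck]
    field_simp [sqrt_factorial_ne_zero k]
  have hint : Integrable (weightedSq φ) := by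
    have hcont : Continuous (weightedSq φ) := by
      have := hd.continuous
      unfold weightedSq
      fun_prop
    refine ⟨hcont.aestronglyMeasurable, ?_⟩
    rw [hasFiniteIntegral_iff_ofReal (ae_of_all _ (weightedSq_nonneg φ)), lintegral_weightedSq hd,
      tsum_factorial_mul_eq h0]
    refine ENNReal.mul_lt_top ENNReal.ofReal_lt_top ?_
    have h5 : ∀ k : ℕ+, ((k : ℕ).factorial : ℝ) * ‖taylorCoeff φ k‖ ^ 2 = ‖c k‖ ^ 2 := by
      intro k
      rw [← hcoeff, norm_mul, mul_pow, Complex.norm_real, Real.norm_eq_abs, sq_abs,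
        Real.sq_sqrt (Nat.cast_nonneg _)]
    simp only [h5]
    rw [← ENNReal.ofReal_tsum_of_nonneg (fun k => by positivity) hc]
    exact ENNReal.ofReal_lt_top
  exact ⟨⟨φ, hd, hint, h0⟩, hcoeff⟩

/-- The coefficients in the basis `e` identify the Bargmann space with `ℓ²`. -/
noncomputable def coeffIsometry : Bargmann →ₗᵢ[ℂ] ℓ²(ℕ+, ℂ) where
  toFun φ := ⟨coeff φ, memlp_iff.2 (hasSum_norm_sq_coeff φ).summable⟩
  map_add' φ ψ := by ext k; exact coeff_add φ ψ k
  map_smul' c φ := by ext k; exact coeff_smul c φ k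
  norm_map' φ := by
    have h := lp.norm_rpow_eq_tsum (p := 2) (by norm_num)
      (⟨coeff φ, memlp_iff.2 (hasSum_norm_sq_coeff φ).summable⟩ : ℓ²(ℕ+, ℂ))
    simp only [ENNReal.toReal_ofNat, Real.rpow_two, (hasSum_norm_sq_coeff φ).tsum_eq] at h
    exact (pow_left_inj₀ (norm_nonneg _) (norm_nonneg _) two_ne_zero).1 h

theorem coeffIsometry_surjective : Function.Surjective coeffIsometry := by
  intro c
  obtain ⟨φ, hφ⟩ := exists_hasSum (memlp_iff.1 c.2)
  exact ⟨φ, by ext k; exact hφ k⟩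

/-- The Hilbert basis `e` of the Bargmann space. -/
noncomputable def basis : HilbertBasis ℕ+ ℂ Bargmann :=
  HilbertBasis.ofRepr (LinearIsometryEquiv.ofSurjective coeffIsometry coeffIsometry_surjective)

theorem basis_repr_apply (φ : Bargmann) (k : ℕ+) : basis.repr φ k = coeff φ k := rfl

instance : CompleteSpace Bargmann :=
  (completeSpace_congr (e := basis.repr.toEquiv) basis.repr.isometry.isUniformEmbedding).2 inferInstance

theorem taylorCoeff_e (k : ℕ+) (n : ℕ) :
    taylorCoeff (e k) n = if n = k then (Real.sqrt (k : ℕ).factorial : ℂ)⁻¹ else 0 := by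
  refine taylorCoeff_of_hasSum
    (a := fun n => if n = k then (Real.sqrt (k : ℕ).factorial : ℂ)⁻¹ else 0) (fun z => ?_) n
  convert hasSum_single (k : ℕ) ?_ using 1
  · simp only [if_true]
    change z ^ (k : ℕ) / (Real.sqrt (k : ℕ).factorial : ℂ) = _
    ring
  · intro m hm
    simp [hm]

theorem basis_apply (k : ℕ+) : basis k = e k := by
  classical
  rw [← basis.repr_symm_single k, LinearIsometryEquiv.symm_apply_eq]
  ext j
  rw [basis_repr_apply, coeff, taylorCoeff_e, lp.single_apply]
  by_cases h : j = k
  · subst h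
    simp [mul_inv_cancel₀ (sqrt_factorial_ne_zero j)]
  · have h' : (j : ℕ) ≠ k := fun hh => h (PNat.coe_injective hh)
    simp [h, h']

theorem inner_e (k : ℕ+) (φ : Bargmann) : inner ℂ (e k) φ = coeff φ k := by
  rw [← basis_apply, ← basis.repr_apply_apply, basis_repr_apply]

theorem hasSum_coeff_smul (φ : Bargmann) : HasSum (fun k => coeff φ k • e k) φ := by
  simpa only [basis_apply, basis_repr_apply] using basis.hasSum_repr φ

end Bargmann

/-! ### The coefficients of the entries -/

open Bargmann

theorem coeff_G (φ : G.domain) (k : ℕ+) :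
    coeff (G φ) k = ((k : ℕ) * ((k : ℕ) - 1) * ((k : ℕ) - 2) : ℝ) * coeff (φ : Bargmann) k := by
  have h := taylorCoeff_gribovExpr φ.1.differentiable k
  rw [coeff, coeff]
  change _ * taylorCoeff (gribovExpr φ.1.1) k = _
  rw [h]
  push_cast
  ring

/-- Square summability of $k^3$ times the coefficients serves as one sufficient condition for the
domains of all entries. Here it works since $|k(k-1)(k-2)|\le k^3$: some element of $\mathcal B$ has
the coefficients of $z^3\varphi'''$, and the two functions agree by uniqueness of Taylor series. -/
theorem mem_G_domain {φ : Bargmann}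
    (h : Summable fun k : ℕ+ => (((k : ℕ) : ℝ) ^ 3 * ‖coeff φ k‖) ^ 2) : φ ∈ G.domain := by
  have hs : Summable fun k : ℕ+ => ‖(k : ℂ) * (k - 1) * (k - 2) * coeff φ k‖ ^ 2 := by
    refine Summable.of_nonneg_of_le (fun k => by positivity) (fun k => ?_) h
    refine pow_le_pow_left₀ (norm_nonneg _) ?_ 2
    rw [norm_mul]
    refine mul_le_mul_of_nonneg_right ?_ (norm_nonneg _)
    have hk : (1 : ℝ) ≤ ((k : ℕ) : ℝ) := by exact_mod_cast k.pos
    have e1 : (k : ℂ) * (k - 1) * (k - 2)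
      = (((k : ℕ) : ℝ) * (((k : ℕ) : ℝ) - 1) * (((k : ℕ) : ℝ) - 2) : ℝ) := by push_cast; rfl
    rw [e1, Complex.norm_real, Real.norm_eq_abs, abs_mul, abs_mul]
    have h1 : |((k : ℕ) : ℝ)| ≤ k := by rw [abs_of_nonneg (by linarith)]
    have h2 : |((k : ℕ) : ℝ) - 1| ≤ k := by rw [abs_le]; constructor <;> linarith
    have h3 : |((k : ℕ) : ℝ) - 2| ≤ k := by rw [abs_le]; constructor <;> linarith
    calc _ ≤ ((k : ℕ) : ℝ) * k * k := by gcongr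
      _ = _ := by ring
  obtain ⟨ψ, hψ⟩ := exists_hasSum hs
  have hd : Differentiable ℂ (gribovExpr φ) := differentiable_of_hasSum
    (hasSum_gribovExpr φ.differentiable)
  change gribovExpr φ.1 ∈ bargmannSubmodule
  have : gribovExpr φ.1 = ψ.1 := by
    refine eq_of_taylorCoeff_eq hd ψ.differentiable fun n => ?_
    rw [taylorCoeff_gribovExpr φ.differentiable]
    rcases Nat.eq_zero_or_pos n with rfl | hn
    · rw [taylorCoeff_zero ψ.1]
      have : ψ.1 0 = 0 := ψ.apply_zero
      simp [this]
    · have h1 := hψ ⟨n, hn⟩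
      simp only [coeff, PNat.mk_coe] at h1
      refine mul_left_cancel₀ (sqrt_factorial_ne_zero n) ?_
      rw [h1]
      ring
  rw [this]
  exact ψ.2

theorem coeff_H0pow (β : ℝ) (φ : (H0pow β).domain) (k : ℕ+) :
    coeff (H0pow β φ) k = (((k : ℕ) : ℝ) ^ β : ℝ) * coeff (φ : Bargmann) k := by
  classical
  have h := (H0pow_hasSum β φ).mapL (innerSL ℂ (e k))
  have h1 := basis.orthonormal
  rw [orthonormal_iff_ite] at h1
  simp only [basis_apply] at h1
  simp only [innerSL_apply_apply, inner_smul_right, h1, inner_e] at h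
  refine h.unique ?_
  convert hasSum_single k ?_ using 1
  · simp
  · intro j hj
    simp [hj.symm]

theorem mem_H0pow_domain {β : ℝ} (hβ : β ≤ 2) {φ : Bargmann}
    (h : Summable fun k : ℕ+ => (((k : ℕ) : ℝ) ^ 3 * ‖coeff φ k‖) ^ 2) :
    φ ∈ (H0pow β).domain := by
  rw [mem_H0pow_domain_iff]
  have hle : ∀ k : ℕ+, ((k : ℕ) : ℝ) ^ β ≤ ((k : ℕ) : ℝ) ^ 3 := by
    intro k
    have hk : (1 : ℝ) ≤ ((k : ℕ) : ℝ) := by exact_mod_cast k.pos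
    rw [← Real.rpow_natCast]
    exact Real.rpow_le_rpow_of_exponent_le hk (by push_cast; linarith)
  have hs : Summable fun k : ℕ+ => ‖((((k : ℕ) : ℝ) ^ β : ℝ) : ℂ) * coeff φ k‖ ^ 2 := by
    refine Summable.of_nonneg_of_le (fun k => by positivity) (fun k => ?_) h
    refine pow_le_pow_left₀ (norm_nonneg _) ?_ 2
    rw [norm_mul, Complex.norm_real, Real.norm_eq_abs, abs_of_nonneg (by positivity)]
    exact mul_le_mul_of_nonneg_right (hle k) (norm_nonneg _)
  obtain ⟨ψ, hψ⟩ := exists_hasSum hs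
  refine ⟨ψ, ?_, ?_⟩
  · refine hs.congr fun k => ?_
    rw [norm_mul, Complex.norm_real, Real.norm_eq_abs, abs_of_nonneg (by positivity), mul_pow,
      ← Real.rpow_mul_natCast (by positivity), inner_e, mul_comm β]
    push_cast
    rfl
  · simpa only [hψ, inner_e] using hasSum_coeff_smul ψ


/-! ### Operators that are diagonal in a Hilbert basis -/

section Diagonal

variable {ι E : Type*} [NormedAddCommGroup E] [InnerProductSpace ℂ E]

theorem hilbertBasis_ext (b : HilbertBasis ι ℂ E) {x y : E}
    (h : ∀ i, inner ℂ (b i) x = inner ℂ (b i) y) : x = y :=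
  b.repr.injective (lp.ext (funext fun i => by simpa only [b.repr_apply_apply] using h i))

theorem summable_norm_sq_inner (b : HilbertBasis ι ℂ E) (x : E) :
    Summable fun i => ‖inner ℂ (b i) x‖ ^ 2 := by
  have h := (lp.memℓp (b.repr x)).summable (by norm_num)
  simpa [b.repr_apply_apply] using h

theorem norm_sq_eq_tsum (b : HilbertBasis ι ℂ E) (x : E) :
    ‖x‖ ^ 2 = ∑' i, ‖inner ℂ (b i) x‖ ^ 2 := by
  have h := lp.norm_rpow_eq_tsum (p := 2) (by norm_num) (b.repr x)
  simpa [b.repr_apply_apply] using h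

theorem exists_inner_eq (b : HilbertBasis ι ℂ E) {c : ι → ℂ} (hc : Summable fun i => ‖c i‖ ^ 2) :
    ∃ x : E, ∀ i, inner ℂ (b i) x = c i := by
  have hm : Memℓp c 2 := by
    rw [memℓp_gen_iff (by norm_num)]
    simpa using hc
  refine ⟨b.repr.symm ⟨c, hm⟩, fun i => ?_⟩
  rw [← b.repr_apply_apply, LinearIsometryEquiv.apply_symm_apply]

/-- Bounded multipliers of the coefficients in a Hilbert basis act as bounded operators. -/
theorem exists_multiplier (b : HilbertBasis ι ℂ E) {m : ι → ℂ} {C : ℝ} (hC : 0 ≤ C)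
    (hm : ∀ i, ‖m i‖ ≤ C) :
    ∃ R : E →L[ℂ] E, ∀ x i, inner ℂ (b i) (R x) = m i * inner ℂ (b i) x := by
  have hle : ∀ (x : E) (i : ι),
      ‖m i * inner ℂ (b i) x‖ ^ 2 ≤ C ^ 2 * ‖inner ℂ (b i) x‖ ^ 2 := by
    intro x i
    rw [norm_mul, mul_pow]
    have := hm i
    gcongr
  have hs : ∀ x : E, Summable fun i => ‖m i * inner ℂ (b i) x‖ ^ 2 := fun x =>
    Summable.of_nonneg_of_le (fun i => by positivity) (hle x)
      ((summable_norm_sq_inner b x).mul_left _)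
  choose f hf using fun x => exists_inner_eq b (hs x)
  let L : E →ₗ[ℂ] E :=
    { toFun := f
      map_add' := fun x y => hilbertBasis_ext b fun i => by
        simp only [inner_add_right, hf, mul_add]
      map_smul' := fun c x => hilbertBasis_ext b fun i => by
        simp only [inner_smul_right, hf, RingHom.id_apply, mul_left_comm] }
  refine ⟨L.mkContinuous C fun x => ?_, hf⟩
  refine (pow_le_pow_iff_left₀ (norm_nonneg _) (by positivity) two_ne_zero).1 ?_
  change ‖f x‖ ^ 2 ≤ _
  rw [norm_sq_eq_tsum b, mul_pow, norm_sq_eq_tsum b x, ← tsum_mul_left]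
  simp only [hf]
  exact (hs x).tsum_le_tsum (hle x) ((summable_norm_sq_inner b x).mul_left _)

/-- An operator that multiplies the coefficients in a Hilbert basis by real numbers, with maximal
domain, has real spectrum. -/
theorem spectrum_subset_real_of_diagonal (T : E →ₗ.[ℂ] E) (b : HilbertBasis ι ℂ E) (μ : ι → ℝ)
    (hT : ∀ (x : T.domain) (i : ι), inner ℂ (b i) (T x) = μ i * inner ℂ (b i) (x : E))
    (hdom : ∀ x y : E, (∀ i, inner ℂ (b i) y = μ i * inner ℂ (b i) x) → x ∈ T.domain) :
    spectrum T ⊆ Set.range ((↑) : ℝ → ℂ) := by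
  intro z hz
  by_contra hr
  refine hz ?_
  have him : z.im ≠ 0 := fun h => hr ⟨z.re, Complex.ext (by simp) (by simp [h])⟩
  have hbound : ∀ i, |z.im| ≤ ‖(μ i : ℂ) - z‖ := by
    intro i
    have := Complex.abs_im_le_norm ((μ i : ℂ) - z)
    simpa using this
  have hpos : 0 < |z.im| := abs_pos.2 him
  have hne : ∀ i, (μ i : ℂ) - z ≠ 0 := fun i => norm_pos_iff.1 (hpos.trans_le (hbound i))
  -- Since every $\mu_i$ is real, $|\mu_i-z|\ge|\mathrm{Im}\,z|>0$, so the formal resolvent is a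
  -- bounded multiplier.
  obtain ⟨R, hR⟩ := exists_multiplier b (m := fun i => ((μ i : ℂ) - z)⁻¹) (C := |z.im|⁻¹)
    (by positivity) (fun i => by
      rw [norm_inv]
      exact inv_anti₀ hpos (hbound i))
  refine ⟨R, fun y => ?_, fun x => ?_⟩
  · have hmem : R y ∈ T.domain := by
      -- The candidate for $TRy$ is $y+zRy$, because $\mu/(\mu-z)=1+z/(\mu-z)$.
      refine hdom (R y) (y + z • R y) fun i => ?_
      rw [inner_add_right, inner_smul_right, hR]
      field_simp [hne i]
      ring
    refine ⟨hmem, hilbertBasis_ext b fun i => ?_⟩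
    rw [inner_sub_right, inner_smul_right, hT ⟨R y, hmem⟩, ← sub_mul, hR, ← mul_assoc,
      mul_inv_cancel₀ (hne i), one_mul]
  · refine hilbertBasis_ext b fun i => ?_
    rw [hR, inner_sub_right, inner_smul_right, hT, ← sub_mul, ← mul_assoc,
      inv_mul_cancel₀ (hne i), one_mul]

end Diagonal

/-! ### Operator matrices whose entries are diagonal in a common Hilbert basis -/

section Blocks

variable {E : Type*} [NormedAddCommGroup E] [InnerProductSpace ℂ E] {n : ℕ}

/-- The vector of the `k`-th coefficients of the components. -/
noncomputable def blockCoeff {κ : Type*} (b : HilbertBasis κ ℂ E) (k : κ)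
    (U : PiLp 2 (fun _ : Fin n => E)) : EuclideanSpace ℂ (Fin n) :=
  WithLp.toLp 2 fun i => inner ℂ (b k) (U i)

/-- The element of `E ^ n` with components `v i • b k`. -/
noncomputable def blockVector {κ : Type*} (b : HilbertBasis κ ℂ E) (k : κ)
    (v : EuclideanSpace ℂ (Fin n)) : PiLp 2 (fun _ : Fin n => E) :=
  WithLp.toLp 2 fun i => v i • b k

/-- Reduces inner products in $E^n$ against block vectors to inner products in $\mathbb C^n$, where
the Hermitian matrices act. -/
theorem inner_blockVector {κ : Type*} (b : HilbertBasis κ ℂ E) (k : κ)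
    (v : EuclideanSpace ℂ (Fin n)) (U : PiLp 2 (fun _ : Fin n => E)) :
    inner ℂ (blockVector b k v) U = inner ℂ v (blockCoeff b k U) := by
  simp only [PiLp.inner_apply, blockVector, blockCoeff, inner_smul_left]
  refine Finset.sum_congr rfl fun i _ => ?_
  simp [mul_comm]

theorem blockCoeff_blockVector {κ : Type*} [DecidableEq κ] (b : HilbertBasis κ ℂ E) (k l : κ)
    (v : EuclideanSpace ℂ (Fin n)) :
    blockCoeff b k (blockVector b l v) = if k = l then v else 0 := by
  have h1 := b.orthonormal
  rw [orthonormal_iff_ite] at h1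
  ext i
  simp only [blockCoeff, blockVector, inner_smul_right, h1]
  split_ifs <;> simp

theorem ext_blockCoeff {κ : Type*} (b : HilbertBasis κ ℂ E) {U V : PiLp 2 (fun _ : Fin n => E)}
    (h : ∀ k, blockCoeff b k U = blockCoeff b k V) : U = V := by
  ext i
  exact hilbertBasis_ext b fun k => congrArg (fun w : EuclideanSpace ℂ (Fin n) => w i) (h k)

theorem orthonormal_blockVector {κ : Type*} (b : HilbertBasis κ ℂ E)
    (v : κ → OrthonormalBasis (Fin n) ℂ (EuclideanSpace ℂ (Fin n))) :
    Orthonormal ℂ fun q : κ × Fin n => blockVector b q.1 (v q.1 q.2) := by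
  classical
  rw [orthonormal_iff_ite]
  rintro ⟨k, i⟩ ⟨l, j⟩
  rw [inner_blockVector, blockCoeff_blockVector]
  by_cases h : k = l
  · subst h
    have := (v k).orthonormal
    rw [orthonormal_iff_ite] at this
    simp [this]
  · simp [h]

/-- The Hilbert basis of `E ^ n` obtained from a Hilbert basis of `E` and a family of orthonormal
bases of `ℂ ^ n`. -/
noncomputable def blockBasis [CompleteSpace E] {κ : Type*} (b : HilbertBasis κ ℂ E)
    (v : κ → OrthonormalBasis (Fin n) ℂ (EuclideanSpace ℂ (Fin n))) :
    HilbertBasis (κ × Fin n) ℂ (PiLp 2 (fun _ : Fin n => E)) :=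
  HilbertBasis.mkOfOrthogonalEqBot (orthonormal_blockVector b v) <| by
    rw [Submodule.eq_bot_iff]
    intro U hU
    rw [Submodule.mem_orthogonal] at hU
    refine ext_blockCoeff b fun k => ?_
    have h0 : blockCoeff b k (0 : PiLp 2 (fun _ : Fin n => E)) = 0 := by
      ext i
      simp [blockCoeff]
    rw [h0]
    refine hilbertBasis_ext (v k).toHilbertBasis fun i => ?_
    rw [OrthonormalBasis.coe_toHilbertBasis, inner_zero_right, ← inner_blockVector]
    exact hU _ (Submodule.subset_span ⟨(k, i), rfl⟩)

theorem blockBasis_apply [CompleteSpace E] {κ : Type*} (b : HilbertBasis κ ℂ E)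
    (v : κ → OrthonormalBasis (Fin n) ℂ (EuclideanSpace ℂ (Fin n))) (q : κ × Fin n) :
    blockBasis b v q = blockVector b q.1 (v q.1 q.2) := by
  rw [blockBasis, HilbertBasis.coe_mkOfOrthogonalEqBot]

/-- An operator in `E ^ n` that acts on the vectors of `k`-th coefficients by Hermitian matrices,
with maximal domain, has real spectrum and an orthonormal basis of eigenvectors. -/
theorem spectrum_subset_real_and_hasOrthonormalEigenbasis [CompleteSpace E] {κ : Type}
    (T : PiLp 2 (fun _ : Fin n => E) →ₗ.[ℂ] PiLp 2 (fun _ : Fin n => E))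
    (b : HilbertBasis κ ℂ E) (M : κ → Matrix (Fin n) (Fin n) ℂ) (hM : ∀ k, (M k).IsHermitian)
    (hT : ∀ (U : T.domain) (k : κ), blockCoeff b k (T U) =
      WithLp.toLp 2 ((M k).mulVec (blockCoeff b k (U : PiLp 2 (fun _ : Fin n => E)))))
    (hdom : ∀ U V : PiLp 2 (fun _ : Fin n => E),
      (∀ k, blockCoeff b k V = WithLp.toLp 2 ((M k).mulVec (blockCoeff b k U))) → U ∈ T.domain) :
    spectrum T ⊆ Set.range ((↑) : ℝ → ℂ) ∧ HasOrthonormalEigenbasis T := by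
  classical
  set v := fun k => (hM k).eigenvectorBasis with hv
  set μ : κ × Fin n → ℝ := fun q => (hM q.1).eigenvalues q.2 with hμ
  have hMv : ∀ (k : κ) (i : Fin n),
      WithLp.toLp 2 ((M k).mulVec (v k i)) = (μ (k, i) : ℂ) • v k i := by
    intro k i
    have := (hM k).mulVec_eigenvectorBasis i
    ext j
    have := congrFun this j
    simpa using this
  have hsymm : ∀ (k : κ) (i : Fin n) (w : EuclideanSpace ℂ (Fin n)),
      inner ℂ (v k i) (WithLp.toLp 2 ((M k).mulVec w)) = μ (k, i) * inner ℂ (v k i) w := by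
    intro k i w
    have h1 : inner ℂ (v k i) (WithLp.toLp 2 ((M k).mulVec w))
        = inner ℂ (WithLp.toLp 2 ((M k).mulVec (v k i))) w := by
      have h := Matrix.isSymmetric_toEuclideanLin_iff.2 (hM k) (v k i) w
      exact h.symm
    rw [h1, hMv, inner_smul_left]
    simp
  refine ⟨spectrum_subset_real_of_diagonal T (blockBasis b v) μ ?_ ?_,
    κ × Fin n, blockBasis b v, ?_⟩
  · rintro U ⟨k, i⟩
    rw [blockBasis_apply, inner_blockVector, inner_blockVector, hT, hsymm]
  · intro U V h
    refine hdom U V fun k => ?_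
    refine hilbertBasis_ext (v k).toHilbertBasis fun i => ?_
    have h1 := h (k, i)
    rw [blockBasis_apply, inner_blockVector, inner_blockVector] at h1
    rw [OrthonormalBasis.coe_toHilbertBasis, h1, hsymm]
  · rintro ⟨k, i⟩
    rw [blockBasis_apply]
    -- The eigenvalue equation is stated first on coefficients, without assuming membership in the
    -- domain; maximality (`hdom`) then yields that membership.
    have key : ∀ l, blockCoeff b l ((μ (k, i) : ℂ) • blockVector b k (v k i)) =
        WithLp.toLp 2 ((M l).mulVec (blockCoeff b l (blockVector b k (v k i)))) := by
      intro l
      have e1 : blockCoeff b l ((μ (k, i) : ℂ) • blockVector b k (v k i))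
          = (μ (k, i) : ℂ) • blockCoeff b l (blockVector b k (v k i)) := by
        ext j
        simp [blockCoeff]
      rw [e1, blockCoeff_blockVector]
      split_ifs with h
      · subst h
        rw [hMv]
      · ext j
        simp
    have hmem := hdom _ _ key
    refine ⟨hmem, μ (k, i), ext_blockCoeff b fun l => ?_⟩
    rw [hT, key]

end Blocks


open Bargmann

/-! ### The Gribov matrix -/

theorem p_comm (a : ℝ) (i j : ℕ) : p a i j = p a j i := by
  unfold p
  rw [add_comm i j]
  congr 1
  simp only [eq_iff_iff]
  tauto

theorem p_pos {a : ℝ} (ha : 7 / 5 ≤ a) (i j : ℕ) : 0 < p a i j := by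
  have : 0 < a := by linarith
  unfold p
  split_ifs <;> positivity

/-- The bound $2/3$ makes the exponent $3p_{ij}$ at most $2$, one less than the order of growth of
$G$. It holds because $a^2\ge 49/25>3/2$ and the exponent of $a$ is at least $2$. -/
theorem p_le {a : ℝ} (ha : 7 / 5 ≤ a) (i j : ℕ) : p a (i + 1) (j + 1) ≤ 2 / 3 := by
  unfold p
  split_ifs
  · norm_num
  · have h1 : (3 / 2 : ℝ) ≤ a ^ (i + 1 + (j + 1)) := by
      have h2 : a ^ 2 ≤ a ^ (i + 1 + (j + 1)) := pow_le_pow_right₀ (by linarith) (by omega)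
      nlinarith
    rw [div_le_iff₀ (by linarith)]
    linarith

/-- The real symmetric matrix by which the Gribov matrix acts on the `k`-th coefficients. -/
noncomputable def blockEntry (n : ℕ) (a lam : ℝ) (k : ℕ+) (i j : Fin n) : ℝ :=
  if i = j then lam * (((k : ℕ) : ℝ) * (((k : ℕ) : ℝ) - 1) * (((k : ℕ) : ℝ) - 2))
  else p a (i + 1) (j + 1) * ((k : ℕ) : ℝ) ^ (3 * p a (i + 1) (j + 1))

/-- The matrix `blockEntry` with complex entries. -/
noncomputable def blockMatrix (n : ℕ) (a lam : ℝ) (k : ℕ+) : Matrix (Fin n) (Fin n) ℂ :=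
  Matrix.of fun i j => (blockEntry n a lam k i j : ℂ)

theorem blockEntry_comm (n : ℕ) (a lam : ℝ) (k : ℕ+) (i j : Fin n) :
    blockEntry n a lam k i j = blockEntry n a lam k j i := by
  unfold blockEntry
  rw [p_comm a (i + 1)]
  simp only [eq_comm]

theorem blockMatrix_isHermitian (n : ℕ) (a lam : ℝ) (k : ℕ+) :
    (blockMatrix n a lam k).IsHermitian := by
  ext i j
  simp [blockMatrix, Matrix.conjTranspose_apply, blockEntry_comm n a lam k i j]

theorem abs_blockEntry_le {n : ℕ} {a : ℝ} (ha : 7 / 5 ≤ a) (lam : ℝ) (k : ℕ+) {i j : Fin n}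
    (hij : i ≠ j) : |blockEntry n a lam k i j| ≤ ((k : ℕ) : ℝ) ^ 2 := by
  have h1 := p_pos ha (i + 1) (j + 1)
  have h2 := p_le ha i j
  have hk : (1 : ℝ) ≤ ((k : ℕ) : ℝ) := by exact_mod_cast k.pos
  rw [blockEntry, if_neg hij, abs_of_nonneg (by positivity)]
  have h3 : ((k : ℕ) : ℝ) ^ (3 * p a (i + 1) (j + 1)) ≤ ((k : ℕ) : ℝ) ^ 2 := by
    rw [← Real.rpow_natCast]
    exact Real.rpow_le_rpow_of_exponent_le hk (by push_cast; linarith)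
  have h4 : (0 : ℝ) ≤ ((k : ℕ) : ℝ) ^ (3 * p a (i + 1) (j + 1)) := by positivity
  nlinarith

/-- The entries of the Gribov matrix. -/
noncomputable def gribovEntry (n : ℕ) (a lam : ℝ) (i j : Fin n) : Bargmann →ₗ.[ℂ] Bargmann :=
  if i = j then (lam : ℂ) • G
  else (p a (i + 1) (j + 1) : ℂ) • H0pow (3 * p a (i + 1) (j + 1))

theorem coeff_gribovEntry (n : ℕ) (a lam : ℝ) (i j : Fin n)
    (φ : (gribovEntry n a lam i j).domain) (k : ℕ+) :
    coeff (gribovEntry n a lam i j φ) k = blockEntry n a lam k i j * coeff (φ : Bargmann) k := by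
  revert φ
  by_cases h : i = j
  · have h1 : gribovEntry n a lam i j = (lam : ℂ) • G := if_pos h
    rw [h1, blockEntry, if_pos h]
    intro φ
    rw [LinearPMap.smul_apply, coeff_smul]
    rw [coeff_G φ k]
    push_cast
    ring
  · have h1 : gribovEntry n a lam i j
        = (p a (i + 1) (j + 1) : ℂ) • H0pow (3 * p a (i + 1) (j + 1)) := if_neg h
    rw [h1, blockEntry, if_neg h]
    intro φ
    rw [LinearPMap.smul_apply, coeff_smul]
    rw [coeff_H0pow _ φ k]
    push_cast
    ring

theorem mem_gribovEntry_domain (n : ℕ) {a : ℝ} (ha : 7 / 5 ≤ a) (lam : ℝ) (i j : Fin n)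
    {φ : Bargmann} (h : Summable fun k : ℕ+ => (((k : ℕ) : ℝ) ^ 3 * ‖coeff φ k‖) ^ 2) :
    φ ∈ (gribovEntry n a lam i j).domain := by
  unfold gribovEntry
  split_ifs
  · exact mem_G_domain h
  · exact mem_H0pow_domain (by have := p_le ha i j; linarith) h

theorem blockCoeff_basis_apply {n : ℕ} (k : ℕ+) (U : PiLp 2 (fun _ : Fin n => Bargmann))
    (i : Fin n) : blockCoeff basis k U i = coeff (U i) k := by
  simp [blockCoeff, basis_apply, inner_e]

theorem coeff_sum {n : ℕ} (f : Fin n → Bargmann) (k : ℕ+) :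
    coeff (∑ j, f j) k = ∑ j, coeff (f j) k := by
  simp only [← inner_e, inner_sum]

theorem blockCoeff_gribovMatrix (n : ℕ) (a lam : ℝ) (U : (gribovMatrix n a lam).domain) (k : ℕ+) :
    blockCoeff basis k (gribovMatrix n a lam U) = WithLp.toLp 2 ((blockMatrix n a lam k).mulVec
      (blockCoeff basis k (U : PiLp 2 (fun _ : Fin n => Bargmann)))) := by
  ext i
  rw [blockCoeff_basis_apply]
  change coeff (∑ j, gribovEntry n a lam i j ⟨U.1 j, U.2 j i⟩) k = _
  rw [coeff_sum]
  simp only [coeff_gribovEntry, Matrix.mulVec, dotProduct, blockMatrix, Matrix.of_apply,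
    blockCoeff_basis_apply]

/-- The growth of the diagonal dominates the off-diagonal entries. -/
theorem cube_mul_norm_le {n : ℕ} {a lam : ℝ} (ha : 7 / 5 ≤ a) (hlam : lam ≠ 0) {k : ℕ+}
    (hk3 : 3 ≤ (k : ℕ)) (hk : 9 * n ≤ |lam| * (k : ℕ)) {u w : Fin n → ℂ}
    (hw : w = (blockMatrix n a lam k).mulVec u) (j : Fin n) :
    ((k : ℕ) : ℝ) ^ 3 * ‖u j‖ ≤ 9 / |lam| * ∑ i, ‖w i‖ := by
  have hl : 0 < |lam| := abs_pos.2 hlam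
  set x : ℝ := ((k : ℕ) : ℝ) with hx
  have hx3 : 3 ≤ x := by rw [hx]; exact_mod_cast hk3
  -- The ratio $(x-1)(x-2)/x^2$ equals $2/9$ at $x=3$; the difference of the two sides is
  -- $x(x-3)(7x-6)/9$.
  have hdiag : 2 / 9 * x ^ 3 ≤ x * (x - 1) * (x - 2) := by
    nlinarith [mul_nonneg (by linarith : 0 ≤ x) (by nlinarith : 0 ≤ (x - 3) * (7 * x - 6))]
  have hd0 : 0 ≤ x * (x - 1) * (x - 2) := le_trans (by positivity) hdiag
  have hi : ∀ i, |lam| * (x * (x - 1) * (x - 2)) * ‖u i‖ ≤ ‖w i‖ + x ^ 2 * ∑ l, ‖u l‖ := by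
    intro i
    have h1 : w i = (blockEntry n a lam k i i : ℂ) * u i
        + ∑ l ∈ Finset.univ.erase i, (blockEntry n a lam k i l : ℂ) * u l := by
      rw [hw, Finset.add_sum_erase _ (fun l => (blockEntry n a lam k i l : ℂ) * u l)
        (Finset.mem_univ i)]
      rfl
    have h2 : ‖(blockEntry n a lam k i i : ℂ) * u i‖
        = |lam| * (x * (x - 1) * (x - 2)) * ‖u i‖ := by
      rw [norm_mul, Complex.norm_real, Real.norm_eq_abs, blockEntry, if_pos rfl, abs_mul,
        abs_of_nonneg hd0]
    have h3 : ‖∑ l ∈ Finset.univ.erase i, (blockEntry n a lam k i l : ℂ) * u l‖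
        ≤ x ^ 2 * ∑ l, ‖u l‖ := by
      refine (norm_sum_le _ _).trans ?_
      rw [Finset.mul_sum]
      refine (Finset.sum_le_sum fun l hl => ?_).trans
        (Finset.sum_le_sum_of_subset_of_nonneg (Finset.erase_subset i _)
          fun l _ _ => by positivity)
      rw [norm_mul, Complex.norm_real, Real.norm_eq_abs]
      exact mul_le_mul_of_nonneg_right
        (abs_blockEntry_le ha lam k (Finset.ne_of_mem_erase hl).symm) (norm_nonneg _)
    rw [← h2, eq_sub_of_add_eq h1.symm]
    exact (norm_sub_le _ _).trans (add_le_add_right h3 _)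
  -- Each row is perturbed by the sum $S$ of all components, so the rows are added to get an
  -- inequality for $S$ alone, at the cost of a factor $n$.
  have hsum := Finset.sum_le_sum fun i (_ : i ∈ Finset.univ) => hi i
  rw [← Finset.mul_sum, Finset.sum_add_distrib, Finset.sum_const, Finset.card_univ,
    Fintype.card_fin, nsmul_eq_mul] at hsum
  set S := ∑ l, ‖u l‖ with hS
  have hS0 : 0 ≤ S := Finset.sum_nonneg fun l _ => norm_nonneg _
  have h5 : |lam| * (2 / 9 * x ^ 3) * S ≤ |lam| * (x * (x - 1) * (x - 2)) * S := by gcongr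
  -- By `hk` the off-diagonal part uses up at most half of the diagonal's $\frac29|\lambda''|x^3S$;
  -- the other half produces the constant $9/|\lambda''|$.
  have h6 : (n : ℝ) * (x ^ 2 * S) ≤ |lam| / 9 * x ^ 3 * S := by
    have := mul_le_mul_of_nonneg_right hk (by positivity : 0 ≤ x ^ 2 * S)
    nlinarith
  have h7 : x ^ 3 * S ≤ 9 / |lam| * ∑ i, ‖w i‖ := by
    rw [div_mul_eq_mul_div, le_div_iff₀ hl]
    nlinarith
  refine le_trans ?_ h7
  have : ‖u j‖ ≤ S := Finset.single_le_sum (fun l _ => norm_nonneg (u l)) (Finset.mem_univ j)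
  gcongr

theorem summable_sum_norm_sq {n : ℕ} (V : PiLp 2 (fun _ : Fin n => Bargmann)) :
    Summable fun k : ℕ+ => (∑ i, ‖coeff (V i) k‖) ^ 2 := by
  refine Summable.of_nonneg_of_le (fun k => by positivity)
    (fun k => sq_sum_le_card_mul_sum_sq) ?_
  refine Summable.mul_left _ (summable_sum fun i _ => ?_)
  exact (hasSum_norm_sq_coeff (V i)).summable

/-- Maximality of the domain. The estimate `cube_mul_norm_le` compares $k^3$ times the coefficients
of $U$ with those of $V$ for large $k$, and the finitely many remaining $k$ do not affect
summability. -/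
theorem mem_gribovMatrix_domain {n : ℕ} {a lam : ℝ} (ha : 7 / 5 ≤ a) (hlam : lam ≠ 0)
    {U V : PiLp 2 (fun _ : Fin n => Bargmann)}
    (h : ∀ k, blockCoeff basis k V
      = WithLp.toLp 2 ((blockMatrix n a lam k).mulVec (blockCoeff basis k U))) :
    U ∈ (gribovMatrix n a lam).domain := by
  intro j i
  refine mem_gribovEntry_domain n ha lam i j ?_
  have hl : 0 < |lam| := abs_pos.2 hlam
  refine Summable.of_norm_bounded_eventually
    ((summable_sum_norm_sq V).mul_left ((9 / |lam|) ^ 2)) ?_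
  -- Beyond this $N$ one has $9n\le|\lambda''|k$; the maximum with $3$ below serves the lower bound
  -- on the diagonal.
  obtain ⟨N, hN⟩ := exists_nat_ge (9 * n / |lam|)
  have hfin : {k : ℕ+ | (k : ℕ) < max 3 N}.Finite :=
    (Set.finite_lt_nat (max 3 N)).preimage PNat.coe_injective.injOn
  refine Filter.mem_of_superset hfin.compl_mem_cofinite fun k hk => ?_
  have hk' : max 3 N ≤ (k : ℕ) := not_lt.1 hk
  have hkN : (N : ℝ) ≤ ((k : ℕ) : ℝ) := by exact_mod_cast (le_max_right 3 N).trans hk'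
  have hb := cube_mul_norm_le ha hlam (k := k) ((le_max_left 3 N).trans hk')
    (by
      have := (div_le_iff₀ hl).1 (hN.trans hkN)
      linarith)
    (congrArg (fun w : EuclideanSpace ℂ (Fin n) => w.ofLp) (h k)) j
  simp only [blockCoeff_basis_apply] at hb
  change ‖(((k : ℕ) : ℝ) ^ 3 * ‖coeff (U j) k‖) ^ 2‖ ≤ _
  rw [Real.norm_eq_abs, abs_of_nonneg (by positivity), ← mul_pow]
  exact pow_le_pow_left₀ (by positivity) hb 2

end Gribov

theorem proposition3p11 (n : ℕ) (a lam : ℝ) (ha : 7 / 5 ≤ a) (hlam : lam ≠ 0)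
    (hγ : 5 / |lam| < 1) :
    Gribov.spectrum (Gribov.gribovMatrix n a lam) ⊆ Set.range ((↑) : ℝ → ℂ) ∧
      Gribov.HasOrthonormalEigenbasis (Gribov.gribovMatrix n a lam) := by
  exact Gribov.spectrum_subset_real_and_hasOrthonormalEigenbasis _ Gribov.Bargmann.basis
    (Gribov.blockMatrix n a lam) (Gribov.blockMatrix_isHermitian n a lam)
    (Gribov.blockCoeff_gribovMatrix n a lam)
    (fun _ _ => Gribov.mem_gribovMatrix_domain ha hlam)
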